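/- Let $\mathcal{R}=\{R_1,\dots,R_n\}$ be a finite family of closed axis-parallel rectangles in the plane, $R_i=[a_i,b_i]\times[c_i,d_i]$ with $a_i<b_i$ and $c_i<d_i$. Two rectangles intersect if they share a common point, and they cross if they intersect but neither of them contains a corner of the other. Suppose that $\mathcal{R}$ is triangle-free, i.e. no three rectangles of $\mathcal{R}$ are pairwise intersecting, and non-crossing, i.e. no two rectangles of $\mathcal{R}$ cross. Then the intersection graph $G_{\mathcal{R}}$, whose vertices are the rectangles of $\mathcal{R}$ and in which two distinct rectangles are adjacent if and only if they intersect, is planar: it can be drawn in the plane with distinct points as vertices and simple arcs as edges, such that no arc passes through a vertex other than its two ends and any two distinct arcs meet only in common end vertices. -/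

import Mathlib

/-- A closed axis-parallel rectangle `[left, right] × [bottom, top]` in the plane. -/
structure AxisRect where
  left : ℝ
  right : ℝ
  bottom : ℝ
  top : ℝ
  left_lt_right : left < right
  bottom_lt_top : bottom < top

namespace AxisRect

/-- The set of points of the rectangle. -/
def carrier (R : AxisRect) : Set (ℝ × ℝ) :=
  Set.Icc R.left R.right ×ˢ Set.Icc R.bottom R.top

/-- The four corners of the rectangle. -/
def corners (R : AxisRect) : Set (ℝ × ℝ) :=
  {R.left, R.right} ×ˢ {R.bottom, R.top}

/-- Two rectangles intersect if they share a common point. -/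
def Intersects (R S : AxisRect) : Prop :=
  (R.carrier ∩ S.carrier).Nonempty

/-- Two rectangles cross if they intersect, but neither contains a corner of the other. -/
def Crosses (R S : AxisRect) : Prop :=
  R.Intersects S ∧ (∀ p ∈ S.corners, p ∉ R.carrier) ∧ (∀ p ∈ R.corners, p ∉ S.carrier)

theorem Intersects.symm {R S : AxisRect} (h : R.Intersects S) : S.Intersects R := by
  unfold Intersects at h ⊢
  rwa [Set.inter_comm]

/-- No three members of the family are pairwise intersecting. -/
def TriangleFree {ι : Type*} (R : ι → AxisRect) : Prop :=
  ∀ i j k : ι, i ≠ j → j ≠ k → i ≠ k →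
    ¬ ((R i).Intersects (R j) ∧ (R j).Intersects (R k) ∧ (R i).Intersects (R k))

/-- No two members of the family cross. -/
def NonCrossing {ι : Type*} (R : ι → AxisRect) : Prop :=
  ∀ i j : ι, ¬ (R i).Crosses (R j)

/-- The intersection graph of a family of rectangles: one vertex for each member,
two different members being adjacent if they intersect. -/
def intersectionGraph {ι : Type*} (R : ι → AxisRect) : SimpleGraph ι where
  Adj i j := i ≠ j ∧ (R i).Intersects (R j)
  symm := ⟨fun _ _ h => ⟨h.1.symm, h.2.symm⟩⟩
  loopless := ⟨fun _ h => h.1 rfl⟩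

end AxisRect

/-- A drawing of a graph in the plane without crossings: vertices are distinct points, every edge
is a simple arc joining its two end vertices, an arc passes through no vertex other than its ends,
and the arcs of two different edges meet in common end vertices only. -/
structure PlaneDrawing {V : Type*} (G : SimpleGraph V) where
  point : V → ℝ × ℝ
  arc : Sym2 V → Set (ℝ × ℝ)
  point_injective : Function.Injective point
  arc_simple : ∀ u v : V, G.Adj u v →
    ∃ γ : Path (point u) (point v), Function.Injective γ ∧ Set.range γ = arc s(u, v)
  vertex_mem_arc : ∀ e ∈ G.edgeSet, ∀ w : V, point w ∈ arc e → w ∈ e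
  arc_inter_arc : ∀ e ∈ G.edgeSet, ∀ f ∈ G.edgeSet, e ≠ f →
    arc e ∩ arc f ⊆ point '' {w | w ∈ e ∧ w ∈ f}

/-- A graph is planar if it can be drawn in the plane without crossings. -/
def IsPlanarGraph {V : Type*} (G : SimpleGraph V) : Prop :=
  Nonempty (PlaneDrawing G)

/-!
Call a rectangle of the family a leaf if it is contained in another one (of two equal rectangles only
one counts, see `AxisRect.ContainedIn`). Anything that meets it also
meets the rectangle around it, so by triangle-freeness that rectangle is its only neighbor, and is
itself not a leaf (`AxisRect.ContainedIn.eq_of_intersects`,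
`AxisRect.ContainedIn.not_containedIn`).

Two intersecting rectangles `R`, `S` that do not cross and do not contain each other are separated by
a line in a weak sense (`AxisRect.exists_separates`): it passes through a point of `R ∩ S` and has
`R \ S` on one side and `S \ R` on the other. If one of the two sticks into the other through a side,
the line is that side; if they overlap at corners, it is the diagonal of `R ∩ S` through the two points
where the boundaries meet. Cutting each rectangle that is not a leaf along its lines leaves a convex
region (`AxisRect.region`).

* Different regions have no common interior point, as two adjacent ones lie on opposite sides of a
  line.
* A region contains all points of its rectangle that lie in no other one. Such points exist, as the
  connected rectangle is not the union of its disjoint closed intersections with the others; so the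
  region has interior points.
* The chosen point of `R ∩ S` on the line of `R` and `S` belongs to both regions: by
  triangle-freeness it lies in no third rectangle, hence on the right side of all other lines.

Now put each vertex inside its region and join it by segments to the chosen points on the boundary.
By convexity these segments stay in the interior until they reach their ends, so segments in
different regions meet in chosen points only, and those in one region form a star. Each pair of
adjacent non-leaves is thus joined by a path of two segments, and the leaves of a vertex are placed
near it in further directions (`isPlanarGraph_of_convex_regions`).
-/

/-! ### Plane drawings made of half-edges in disjoint cells -/

/-- The concatenation of two simple arcs that share only the common end is simple. -/
theorem Path.trans_injective {X : Type*} [TopologicalSpace X] {x y z : X}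
    {γ : Path x y} {δ : Path y z} (hγ : Function.Injective γ) (hδ : Function.Injective δ)
    (h : Set.range γ ∩ Set.range δ ⊆ {y}) : Function.Injective (γ.trans δ) := by
  have key : ∀ s t : unitInterval, γ s = δ t → s = 1 ∧ t = 0 := by
    intro s t hst
    have hy : γ s = y := h ⟨⟨s, rfl⟩, ⟨t, hst.symm⟩⟩
    exact ⟨hγ (hy.trans γ.target.symm), hδ ((hst.symm.trans hy).trans δ.source.symm)⟩
  intro s t hst
  rw [Path.trans_apply, Path.trans_apply] at hst
  apply Subtype.ext
  split_ifs at hst with h₁ h₂ h₂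
  · have := congrArg Subtype.val (hγ hst)
    simp only at this
    linarith
  · have := (key _ _ hst).2
    have := congrArg Subtype.val this
    simp only [Set.Icc.coe_zero] at this
    linarith
  · have := (key _ _ hst.symm).2
    have := congrArg Subtype.val this
    simp only [Set.Icc.coe_zero] at this
    linarith
  · have := congrArg Subtype.val (hδ hst)
    simp only at this
    linarith

/-- If two segments from `p` share a point other than `p`, the one that reaches it later in its
parametrization has its end on the other. -/
theorem exists_lineMap_eq_of_lineMap_eq {p q r : ℝ × ℝ} {s t : ℝ} (hs : 0 ≤ s) (hst : s ≤ t)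
    (h : AffineMap.lineMap p q s = (AffineMap.lineMap p r t : ℝ × ℝ)) :
    (AffineMap.lineMap p q s : ℝ × ℝ) = p ∨
      ∃ c : ℝ, 0 ≤ c ∧ c ≤ 1 ∧ r = AffineMap.lineMap p q c := by
  rcases hs.eq_or_lt with rfl | hs
  · left; simp
  right
  have ht : 0 < t := hs.trans_le hst
  refine ⟨s / t, by positivity, (div_le_one ht).2 hst, ?_⟩
  simp only [AffineMap.lineMap_apply_module'] at h ⊢
  have h' : s • (q - p) = t • (r - p) := by simpa using h
  rw [div_eq_inv_mul, mul_smul, h', smul_smul, inv_mul_cancel₀ ht.ne', one_smul]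
  simp

/-- If the vertices lie in pairwise disjoint cells, and every edge `e` has a bend point `q e` outside
of all cells such that the segment from an end `v` of `e` to `q e` stays in the cell of `v` until it
reaches `q e`, then these pairs of segments draw the graph without crossings. -/
theorem isPlanarGraph_of_cells {V : Type*} {G : SimpleGraph V} (p : V → ℝ × ℝ)
    (q : Sym2 V → ℝ × ℝ) (U : V → Set (ℝ × ℝ))
    (hU : ∀ u v x, x ∈ U u → x ∈ U v → u = v) (hp : ∀ v, p v ∈ U v)
    (hseg : ∀ e ∈ G.edgeSet, ∀ v ∈ e, ∀ t : ℝ, 0 ≤ t → t < 1 →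
      AffineMap.lineMap (p v) (q e) t ∈ U v)
    (hq : ∀ e ∈ G.edgeSet, ∀ v, q e ∉ U v) (hinj : Set.InjOn q G.edgeSet) :
    IsPlanarGraph G := by
  have hpq : ∀ e ∈ G.edgeSet, ∀ v, p v ≠ q e := fun e he v h => hq e he v (h ▸ hp v)
  have hmem : ∀ e ∈ G.edgeSet, ∀ v ∈ e, ∀ x ∈ segment ℝ (p v) (q e),
      x = q e ∨ ∃ t : ℝ, 0 ≤ t ∧ t < 1 ∧ x = AffineMap.lineMap (p v) (q e) t ∧ x ∈ U v := by
    intro e he v hv x hx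
    rw [segment_eq_image_lineMap] at hx
    obtain ⟨t, ⟨h0, h1⟩, rfl⟩ := hx
    rcases h1.eq_or_lt with rfl | h1
    · left; simp
    · exact Or.inr ⟨t, h0, h1, rfl, hseg e he v hv t h0 h1⟩
  -- Half-edges at one vertex leave it in different directions, since no bend point is in the cell.
  have hstar : ∀ e ∈ G.edgeSet, ∀ f ∈ G.edgeSet, e ≠ f → ∀ v, v ∈ e → v ∈ f → ∀ s t : ℝ,
      0 ≤ s → s ≤ t →
      AffineMap.lineMap (p v) (q e) s = (AffineMap.lineMap (p v) (q f) t : ℝ × ℝ) →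
      (AffineMap.lineMap (p v) (q e) s : ℝ × ℝ) = p v := by
    intro e he f hf hef v hve hvf s t hs hst h
    rcases exists_lineMap_eq_of_lineMap_eq hs hst h with h | ⟨c, hc0, hc1, hr⟩
    · exact h
    · exfalso
      rcases hc1.eq_or_lt with rfl | hc1
      · rw [AffineMap.lineMap_apply_one] at hr
        exact hef (hinj he hf hr.symm)
      · exact hq f hf v (hr ▸ hseg e he v hve c hc0 hc1)
  refine ⟨⟨p, fun e => {x | ∃ v ∈ e, x ∈ segment ℝ (p v) (q e)}, ?_, ?_, ?_, ?_⟩⟩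
  · intro u v h
    exact hU u v (p u) (hp u) (h ▸ hp v)
  · intro u v huv
    have he : s(u, v) ∈ G.edgeSet := huv
    refine ⟨(Path.segment (p u) (q s(u, v))).trans (Path.segment (p v) (q s(u, v))).symm, ?_, ?_⟩
    · apply Path.trans_injective
      · exact Path.segment_injective_of_ne (hpq _ he u)
      · rw [Path.segment_symm]
        exact Path.segment_injective_of_ne (hpq _ he v).symm
      · rw [Path.symm_range, Path.range_segment, Path.range_segment]
        rintro x ⟨hxu, hxv⟩
        rcases hmem _ he u (by simp) x hxu with h | ⟨-, -, -, -, hu⟩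
        · exact h
        rcases hmem _ he v (by simp) x hxv with h | ⟨-, -, -, -, hv⟩
        · exact h
        exact absurd (hU u v x hu hv) huv.ne
    · rw [Path.trans_range, Path.symm_range, Path.range_segment, Path.range_segment]
      ext x
      simp
  · rintro e he w ⟨v, hv, hx⟩
    rcases hmem e he v hv _ hx with h | ⟨-, -, -, -, h⟩
    · exact absurd h (hpq e he w)
    · exact hU w v _ (hp w) h ▸ hv
  · rintro e he f hf hef x ⟨⟨v, hv, hxv⟩, ⟨w, hw, hxw⟩⟩
    rcases hmem e he v hv x hxv with h | ⟨s, hs0, hs1, hs, hxU⟩ <;>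
      rcases hmem f hf w hw x hxw with h' | ⟨t, ht0, ht1, ht, hxU'⟩
    · exact absurd (hinj he hf (h.symm.trans h')) hef
    · exact absurd (h ▸ hxU') (hq e he w)
    · exact absurd (h' ▸ hxU) (hq f hf v)
    · obtain rfl := hU v w x hxU hxU'
      refine ⟨v, ⟨hv, hw⟩, ?_⟩
      rcases le_total s t with hst | hst
      · exact (hs.trans (hstar e he f hf hef v hv hw s t hs0 hst (hs ▸ ht))).symm
      · exact (ht.trans (hstar f hf e he hef.symm v hw hv t s ht0 hst (ht ▸ hs))).symm

/-! ### Plane drawings in convex regions, with additional leaves -/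

/-- A graph is planar if the vertices outside of a set `L` have convex regions `K v` with non-empty
interiors disjoint from the other regions, adjacent vertices outside of `L` have a bend point `q e`
common to their regions, different edges having different bend points, and each vertex `s` of `L` has
no neighbour but `h s`, which is outside of `L`.

A vertex `v` outside of `L` is placed inside `K v`, and the leaves `s` with `h s = v` are placed
around it within `K v`, in directions other than those of the bend points. -/
theorem isPlanarGraph_of_convex_regions {V : Type*} [Finite V] {G : SimpleGraph V} (L : Set V)
    (h : V → V) (hh : ∀ s ∈ L, h s ∉ L) (hleaf : ∀ s ∈ L, ∀ v, G.Adj s v → v = h s)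
    (K : V → Set (ℝ × ℝ)) (q : Sym2 V → ℝ × ℝ) (hconv : ∀ v ∉ L, Convex ℝ (K v))
    (hne : ∀ v ∉ L, (interior (K v)).Nonempty)
    (hdisj : ∀ u ∉ L, ∀ v ∉ L, u ≠ v → Disjoint (interior (K u)) (K v))
    (hqK : ∀ u ∉ L, ∀ v ∉ L, G.Adj u v → q s(u, v) ∈ K u)
    (hinj : ∀ e ∈ G.edgeSet, ∀ f ∈ G.edgeSet, (∀ v ∈ e, v ∉ L) → (∀ v ∈ f, v ∉ L) →
      q e = q f → e = f) :
    IsPlanarGraph G := by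
  classical
  have hI : ∀ u ∉ L, ∀ v ∉ L, ∀ x, x ∈ interior (K u) → x ∈ interior (K v) → u = v := by
    intro u hu v hv x hxu hxv
    by_contra huv
    exact Set.disjoint_left.1 (hdisj u hu v hv huv) hxu (interior_subset hxv)
  have hqK' : ∀ e ∈ G.edgeSet, (∀ v ∈ e, v ∉ L) → ∀ v ∈ e, q e ∈ K v := by
    rintro e he heL v ⟨w, rfl⟩
    exact hqK v (heL v (by simp)) w (heL w (by simp)) he
  have hqI : ∀ e ∈ G.edgeSet, (∀ v ∈ e, v ∉ L) → ∀ v ∉ L, q e ∉ interior (K v) := by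
    intro e
    induction e with
    | _ a b =>
    intro he heL v hv hx
    have ha := hqK' _ he heL a (by simp)
    have hb := hqK' _ he heL b (by simp)
    have hab : a ≠ b := SimpleGraph.Adj.ne he
    by_cases hva : v = a
    · exact Set.disjoint_left.1 (hdisj v hv b (heL b (by simp)) (hva ▸ hab)) hx hb
    · exact Set.disjoint_left.1 (hdisj v hv a (heL a (by simp)) hva) hx ha
  have hc : ∀ v, ∃ x, v ∉ L → x ∈ interior (K v) := by
    intro v
    by_cases hv : v ∈ L
    · exact ⟨0, fun h => absurd hv h⟩
    · obtain ⟨x, hx⟩ := hne v hv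
      exact ⟨x, fun _ => hx⟩
  choose c hc using hc
  have hε : ∀ v, ∃ ε : ℝ, 0 < ε ∧ (v ∉ L → ∀ r t : ℝ, 0 ≤ r → r ≤ ε → 0 < t → t < 1 →
      c v + r • ((1, t) : ℝ × ℝ) ∈ interior (K v)) := by
    intro v
    by_cases hv : v ∈ L
    · exact ⟨1, one_pos, fun h => absurd hv h⟩
    obtain ⟨δ, hδ, hball⟩ := Metric.isOpen_iff.1 isOpen_interior (c v) (hc v hv)
    refine ⟨δ / 2, by positivity, fun _ r t hr0 hr ht0 ht1 => hball ?_⟩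
    have hn : ‖((1, t) : ℝ × ℝ)‖ ≤ 1 := by
      rw [Prod.norm_def]
      simp [abs_of_pos ht0, ht1.le]
    rw [Metric.mem_ball, dist_eq_norm, add_sub_cancel_left, norm_smul, Real.norm_of_nonneg hr0]
    nlinarith [norm_nonneg ((1, t) : ℝ × ℝ)]
  choose ε hε0 hεK using hε
  -- Distinct slopes for the leaves, avoiding the slopes of the half-edges to the bend points.
  obtain ⟨t, htinj, ht0, ht1, htq⟩ : ∃ t : V → ℝ, Function.Injective t ∧ (∀ s, 0 < t s) ∧
      (∀ s, t s < 1) ∧ ∀ s v e, t s ≠ (q e - c v).2 / (q e - c v).1 := by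
    have hB : (Set.range fun x : V × Sym2 V =>
      (q x.2 - c x.1).2 / (q x.2 - c x.1).1).Finite := Set.finite_range _
    have hinf := (Set.Ioo_infinite (zero_lt_one' ℝ)).sdiff hB
    obtain ⟨g, hg⟩ := Countable.exists_injective_nat V
    let m := hinf.natEmbedding
    refine ⟨fun s => m (g s), fun a b hab => hg (m.injective (Subtype.ext hab)),
      fun s => (m (g s)).2.1.1, fun s => (m (g s)).2.1.2, fun s v e heq => ?_⟩
    exact (m (g s)).2.2 ⟨(v, e), heq.symm⟩
  -- `spoke s r` runs from the vertex `h s` at `r = 0` through the bend point of the edge of `s` at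
  -- `r = ε / 2` to the leaf `s` at `r = ε`.
  let spoke : V → ℝ → ℝ × ℝ := fun s r => c (h s) + r • ((1, t s) : ℝ × ℝ)
  have hspokeK : ∀ s ∈ L, ∀ r, 0 ≤ r → r ≤ ε (h s) → spoke s r ∈ interior (K (h s)) :=
    fun s hs r h0 h1 => hεK (h s) (hh s hs) r (t s) h0 h1 (ht0 s) (ht1 s)
  have hspoke : ∀ s s' r r', h s = h s' → spoke s r = spoke s' r' → r = r' ∧ (0 < r → s = s') := by
    intro s s' r r' hs heq
    simp only [spoke, hs, add_right_inj, Prod.smul_mk, smul_eq_mul, mul_one, Prod.mk.injEq] at heq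
    refine ⟨heq.1, fun hr => htinj ?_⟩
    rw [← heq.1] at heq
    exact mul_left_cancel₀ hr.ne' heq.2
  let p : V → ℝ × ℝ := fun v => if v ∈ L then spoke v (ε (h v)) else c v
  have hp_leaf : ∀ s ∈ L, p s = spoke s (ε (h s)) := fun s hs => if_pos hs
  have hp_core : ∀ v ∉ L, p v = c v := fun v hv => if_neg hv
  -- The cell of a leaf is the outer half of its spoke. The cell of `v` has to avoid these halves.
  let U : V → Set (ℝ × ℝ) := fun v =>
    if v ∈ L then {x | ∃ r, ε (h v) / 2 < r ∧ r ≤ ε (h v) ∧ x = spoke v r}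
    else {x | x ∈ interior (K v) ∧ ∀ s ∈ L, h s = v → ∀ r, ε v / 2 ≤ r → x ≠ spoke s r}
  have hU_leaf : ∀ s ∈ L, ∀ x, x ∈ U s ↔ ∃ r, ε (h s) / 2 < r ∧ r ≤ ε (h s) ∧ x = spoke s r := by
    intro s hs x
    simp only [U, if_pos hs, Set.mem_ofPred_eq]
  have hU_core : ∀ v ∉ L, ∀ x, x ∈ U v ↔
      x ∈ interior (K v) ∧ ∀ s ∈ L, h s = v → ∀ r, ε v / 2 ≤ r → x ≠ spoke s r := by
    intro v hv x
    simp only [U, if_neg hv, Set.mem_ofPred_eq]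
  have hU_leafK : ∀ s ∈ L, ∀ x ∈ U s, x ∈ interior (K (h s)) := by
    intro s hs x hx
    obtain ⟨r, h₁, h₂, rfl⟩ := (hU_leaf s hs x).1 hx
    exact hspokeK s hs r (by linarith [hε0 (h s)]) h₂
  have hU_core_leaf : ∀ v ∉ L, ∀ s ∈ L, ∀ x, x ∈ U v → x ∉ U s := by
    intro v hv s hs x hxv hxs
    have hxK := hU_leafK s hs x hxs
    obtain ⟨hxI, hxS⟩ := (hU_core v hv x).1 hxv
    obtain rfl := hI _ hv _ (hh s hs) x hxI hxK
    obtain ⟨r, h₁, h₂, rfl⟩ := (hU_leaf s hs x).1 hxs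
    exact hxS s hs rfl r h₁.le rfl
  let b : Sym2 V → ℝ × ℝ := fun e =>
    if H : ∃ s ∈ L, e = s(s, h s) then spoke H.choose (ε (h H.choose) / 2) else q e
  have hb_leaf : ∀ s ∈ L, b s(s, h s) = spoke s (ε (h s) / 2) := by
    intro s hs
    have H : ∃ s' ∈ L, s(s, h s) = s(s', h s') := ⟨s, hs, rfl⟩
    have hs' : H.choose = s := by
      rcases Sym2.eq_iff.1 H.choose_spec.2 with h' | h'
      · exact h'.1.symm
      · exact absurd (h'.1 ▸ hs) (hh _ H.choose_spec.1)
    simp only [b, dif_pos H, hs']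
  have hb_core : ∀ e, (∀ v ∈ e, v ∉ L) → b e = q e := by
    intro e he
    have H : ¬ ∃ s' ∈ L, e = s(s', h s') := by
      rintro ⟨s, hs, rfl⟩
      exact he s (by simp) hs
    simp only [b, dif_neg H]
  have hedge : ∀ e ∈ G.edgeSet, (∀ v ∈ e, v ∉ L) ∨ ∃ s ∈ L, e = s(s, h s) := by
    intro e he
    by_contra! hcon
    obtain ⟨⟨s, ⟨v, rfl⟩, hs⟩, hcon⟩ := hcon
    exact hcon s hs (by rw [hleaf s hs v he])
  have hleafK : ∀ s ∈ L, b s(s, h s) ∈ interior (K (h s)) := by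
    intro s hs
    rw [hb_leaf s hs]
    exact hspokeK s hs _ (by linarith [hε0 (h s)]) (by linarith [hε0 (h s)])
  refine isPlanarGraph_of_cells p b U ?_ ?_ ?_ ?_ ?_
  · intro u v x hxu hxv
    by_cases hu : u ∈ L <;> by_cases hv : v ∈ L
    · have hhe := hI _ (hh u hu) _ (hh v hv) x (hU_leafK u hu x hxu) (hU_leafK v hv x hxv)
      obtain ⟨r, h₁, -, rfl⟩ := (hU_leaf u hu x).1 hxu
      obtain ⟨r', -, -, h₂⟩ := (hU_leaf v hv _).1 hxv
      exact (hspoke u v r r' hhe h₂).2 (by linarith [hε0 (h u)])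
    · exact absurd hxu (hU_core_leaf v hv u hu x hxv)
    · exact absurd hxv (hU_core_leaf u hu v hv x hxu)
    · exact hI u hu v hv x ((hU_core u hu x).1 hxu).1 ((hU_core v hv x).1 hxv).1
  · intro v
    by_cases hv : v ∈ L
    · rw [hp_leaf v hv, hU_leaf v hv]
      exact ⟨_, by linarith [hε0 (h v)], le_rfl, rfl⟩
    · rw [hp_core v hv, hU_core v hv]
      refine ⟨hc v hv, fun s hs hsv r hr heq => ?_⟩
      have h0 : spoke s 0 = spoke s r := by rw [← heq]; simp [spoke, hsv]
      linarith [(hspoke s s 0 r rfl h0).1, hε0 v]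
  · intro e he v hve r hr0 hr1
    rcases hedge e he with heL | ⟨s, hs, rfl⟩
    · have hv := heL v hve
      rw [hb_core e heL, hp_core v hv, hU_core v hv]
      constructor
      · rw [AffineMap.lineMap_apply_module]
        exact (hconv v hv).combo_interior_self_mem_interior (hc v hv) (hqK' e he heL v hve)
          (by linarith) hr0 (by ring)
      · intro s hs hsv r' hr' heq
        have hr'0 : 0 < r' := by linarith [hε0 v]
        simp only [spoke, hsv, AffineMap.lineMap_apply_module', add_comm (c v), add_left_inj] at heq
        -- If the segment to `q e` met a spoke, the slope of the segment would be `t s`.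
        have e₁ : r * (q e - c v).1 = r' := by simpa using congrArg Prod.fst heq
        have e₂ : r * (q e - c v).2 = r' * t s := by simpa using congrArg Prod.snd heq
        rw [← e₁, mul_assoc] at e₂
        have hr : r ≠ 0 := by rintro rfl; linarith [zero_mul (q e - c v).1]
        have hx : (q e - c v).1 ≠ 0 := by
          intro h0; rw [h0, mul_zero] at e₁; linarith
        exact htq s v e ((eq_div_iff hx).2 (by rw [mul_comm]; exact (mul_left_cancel₀ hr e₂).symm))
    · rw [hb_leaf s hs]
      rcases Sym2.mem_iff.1 hve with rfl | rfl
      · rw [hp_leaf v hs, hU_leaf v hs]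
        have := hε0 (h v)
        refine ⟨ε (h v) * (1 - r / 2), by nlinarith, by nlinarith, ?_⟩
        rw [AffineMap.lineMap_apply_module]
        simp only [spoke]
        ext <;> simp <;> ring
      · have hv := hh s hs
        have := hε0 (h s)
        have hsp : (AffineMap.lineMap (p (h s)) (spoke s (ε (h s) / 2)) r : ℝ × ℝ) =
            spoke s (r * (ε (h s) / 2)) := by
          rw [hp_core _ hv, AffineMap.lineMap_apply_module]
          simp only [spoke]
          ext <;> simp <;> ring
        rw [hsp, hU_core _ hv]
        refine ⟨hspokeK s hs _ (by positivity) (by nlinarith), fun s' hs' hss r' hr' heq => ?_⟩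
        have := (hspoke s s' _ r' hss.symm heq).1
        nlinarith
  · intro e he v hx
    rcases hedge e he with heL | ⟨s, hs, rfl⟩
    · rw [hb_core e heL] at hx
      by_cases hv : v ∈ L
      · exact hqI e he heL _ (hh v hv) (hU_leafK v hv _ hx)
      · exact hqI e he heL v hv ((hU_core v hv _).1 hx).1
    · have hK := hleafK s hs
      by_cases hv : v ∈ L
      · have hhe := hI _ (hh s hs) _ (hh v hv) _ hK (hU_leafK v hv _ hx)
        rw [hb_leaf s hs] at hx
        obtain ⟨r, h₁, -, h₂⟩ := (hU_leaf v hv _).1 hx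
        have := (hspoke s v _ r hhe h₂).1
        rw [← hhe] at h₁
        linarith
      · obtain ⟨hxK, hxS⟩ := (hU_core v hv _).1 hx
        obtain rfl := hI _ (hh s hs) _ hv _ hK hxK
        exact hxS s hs rfl _ le_rfl (hb_leaf s hs)
  · intro e he f hf hef
    rcases hedge e he with heL | ⟨s, hs, rfl⟩ <;> rcases hedge f hf with hfL | ⟨s', hs', rfl⟩
    · rw [hb_core e heL, hb_core f hfL] at hef
      exact hinj e he f hf heL hfL hef
    · rw [hb_core e heL] at hef
      exact absurd (hef ▸ hleafK s' hs') (hqI e he heL _ (hh s' hs'))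
    · rw [hb_core f hfL] at hef
      exact absurd (hef ▸ hleafK s hs) (hqI f hf hfL _ (hh s hs))
    · have hhe := hI _ (hh s hs) _ (hh s' hs') _ (hleafK s hs) (hef ▸ hleafK s' hs')
      rw [hb_leaf s hs, hb_leaf s' hs'] at hef
      obtain rfl := (hspoke s s' _ _ hhe hef).2 (by linarith [hε0 (h s)])
      rfl

/-! ### Separating two intersecting rectangles by a line -/

namespace AxisRect

theorem mem_carrier {R : AxisRect} {p : ℝ × ℝ} :
    p ∈ R.carrier ↔ (R.left ≤ p.1 ∧ p.1 ≤ R.right) ∧ (R.bottom ≤ p.2 ∧ p.2 ≤ R.top) :=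
  Iff.rfl

theorem mem_corners {R : AxisRect} {p : ℝ × ℝ} :
    p ∈ R.corners ↔ (p.1 = R.left ∨ p.1 = R.right) ∧ (p.2 = R.bottom ∨ p.2 = R.top) :=
  Iff.rfl

theorem convex_carrier (R : AxisRect) : Convex ℝ R.carrier :=
  (convex_Icc _ _).prod (convex_Icc _ _)

theorem isClosed_carrier (R : AxisRect) : IsClosed R.carrier :=
  isClosed_Icc.prod isClosed_Icc

theorem carrier_subset_closure_interior (R : AxisRect) :
    R.carrier ⊆ closure (interior R.carrier) := by
  unfold carrier
  rw [interior_prod_eq, closure_prod_eq, closure_interior_Icc R.left_lt_right.ne,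
    closure_interior_Icc R.bottom_lt_top.ne]

theorem nonempty_carrier (R : AxisRect) : R.carrier.Nonempty :=
  ⟨(R.left, R.bottom), ⟨le_rfl, R.left_lt_right.le⟩, ⟨le_rfl, R.bottom_lt_top.le⟩⟩

theorem intersects_of_subset {R S : AxisRect} (h : R.carrier ⊆ S.carrier) : R.Intersects S := by
  obtain ⟨x, hx⟩ := R.nonempty_carrier
  exact ⟨x, hx, h hx⟩

/-- The value at `x` of the affine function on the plane with coefficients `φ`. -/
def affineEval (φ : ℝ × ℝ × ℝ) (x : ℝ × ℝ) : ℝ :=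
  φ.1 * x.1 + φ.2.1 * x.2 - φ.2.2

theorem affineEval_neg (φ : ℝ × ℝ × ℝ) (x : ℝ × ℝ) : affineEval (-φ) x = -affineEval φ x := by
  simp only [affineEval, Prod.fst_neg, Prod.snd_neg]
  ring

/-- The line `φ = 0` passes through a common point of `R` and `S`, has `R \ S` on its non-positive
side and `S \ R` on its non-negative side. The rest of `R ∩ S` may lie on both sides. -/
structure Separates (φ : ℝ × ℝ × ℝ) (R S : AxisRect) : Prop where
  ne_zero : φ.1 ≠ 0 ∨ φ.2.1 ≠ 0
  nonpos : ∀ x ∈ R.carrier, x ∉ S.carrier → affineEval φ x ≤ 0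
  nonneg : ∀ x ∈ S.carrier, x ∉ R.carrier → 0 ≤ affineEval φ x
  common : ∃ x ∈ R.carrier, x ∈ S.carrier ∧ affineEval φ x = 0

theorem Separates.neg {φ : ℝ × ℝ × ℝ} {R S : AxisRect} (h : Separates φ R S) :
    Separates (-φ) S R where
  ne_zero := by simpa using h.ne_zero
  nonpos x hx hx' := by rw [affineEval_neg]; linarith [h.nonneg x hx hx']
  nonneg x hx hx' := by rw [affineEval_neg]; linarith [h.nonpos x hx hx']
  common := by
    obtain ⟨x, hR, hS, h0⟩ := h.common
    exact ⟨x, hS, hR, by rw [affineEval_neg, h0, neg_zero]⟩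

theorem exists_separates_comm {R S : AxisRect} (h : ∃ φ, Separates φ R S) :
    ∃ φ, Separates φ S R :=
  let ⟨φ, hφ⟩ := h
  ⟨-φ, hφ.neg⟩

/-- The mirror image of a rectangle in the vertical axis. -/
def reflect (R : AxisRect) : AxisRect where
  left := -R.right
  right := -R.left
  bottom := R.bottom
  top := R.top
  left_lt_right := neg_lt_neg R.left_lt_right
  bottom_lt_top := R.bottom_lt_top

/-- The mirror image of a rectangle in the diagonal. -/
def transpose (R : AxisRect) : AxisRect where
  left := R.bottom
  right := R.top
  bottom := R.left
  top := R.right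
  left_lt_right := R.bottom_lt_top
  bottom_lt_top := R.left_lt_right

theorem mem_reflect {R : AxisRect} {x : ℝ × ℝ} :
    x ∈ R.reflect.carrier ↔ (-x.1, x.2) ∈ R.carrier := by
  simp only [mem_carrier, reflect]
  constructor <;> rintro ⟨⟨_, _⟩, _, _⟩ <;> refine ⟨⟨?_, ?_⟩, ?_, ?_⟩ <;> linarith

theorem mem_transpose {R : AxisRect} {x : ℝ × ℝ} :
    x ∈ R.transpose.carrier ↔ (x.2, x.1) ∈ R.carrier := by
  simp only [mem_carrier, transpose]
  exact and_comm

theorem exists_separates_of_reflect {R S : AxisRect}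
    (h : ∃ φ, Separates φ R.reflect S.reflect) : ∃ φ, Separates φ R S := by
  obtain ⟨⟨a, b, c⟩, h⟩ := h
  have hev : ∀ x : ℝ × ℝ, affineEval (-a, b, c) x = affineEval (a, b, c) (-x.1, x.2) := by
    intro x; simp only [affineEval]; ring
  refine ⟨(-a, b, c), by simpa using h.ne_zero, fun x hx hx' => ?_, fun x hx hx' => ?_, ?_⟩
  · rw [hev]
    exact h.nonpos _ (by simpa [mem_reflect] using hx) (by simpa [mem_reflect] using hx')
  · rw [hev]
    exact h.nonneg _ (by simpa [mem_reflect] using hx) (by simpa [mem_reflect] using hx')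
  · obtain ⟨x, hR, hS, h0⟩ := h.common
    exact ⟨(-x.1, x.2), mem_reflect.1 hR, mem_reflect.1 hS, by rw [hev]; simpa using h0⟩

theorem exists_separates_of_transpose {R S : AxisRect}
    (h : ∃ φ, Separates φ R.transpose S.transpose) : ∃ φ, Separates φ R S := by
  obtain ⟨⟨a, b, c⟩, h⟩ := h
  have hev : ∀ x : ℝ × ℝ, affineEval (b, a, c) x = affineEval (a, b, c) (x.2, x.1) := by
    intro x; simp only [affineEval]; ring
  refine ⟨(b, a, c), h.ne_zero.symm, fun x hx hx' => ?_, fun x hx hx' => ?_, ?_⟩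
  · rw [hev]
    exact h.nonpos _ (mem_transpose.2 hx) (fun h' => hx' (mem_transpose.1 h'))
  · rw [hev]
    exact h.nonneg _ (mem_transpose.2 hx) (fun h' => hx' (mem_transpose.1 h'))
  · obtain ⟨x, hR, hS, h0⟩ := h.common
    exact ⟨(x.2, x.1), mem_transpose.1 hR, mem_transpose.1 hS, by rw [hev]; exact h0⟩

/-- If `S` enters `R` from the right and its vertical extent is within that of `R`, the right side
of `R` separates them. -/
theorem exists_separates_right {R S : AxisRect} (hb : R.bottom ≤ S.bottom) (ht : S.top ≤ R.top)
    (h₁ : R.left ≤ S.left) (h₂ : S.left ≤ R.right) (h₃ : R.right ≤ S.right) :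
    ∃ φ, Separates φ R S := by
  have := S.bottom_lt_top
  have := R.left_lt_right
  refine ⟨(1, 0, R.right), by simp, fun x hx _ => ?_, fun x hx hx' => ?_,
    (R.right, S.bottom), ?_, ?_, ?_⟩
  · rw [mem_carrier] at hx
    simp only [affineEval]
    linarith
  · rw [mem_carrier] at hx hx'
    simp only [affineEval]
    by_contra hlt
    exact hx' ⟨⟨by linarith, by linarith⟩, by linarith, by linarith⟩
  · simp only [mem_carrier]
    exact ⟨⟨by linarith, by linarith⟩, by linarith, by linarith⟩
  · simp only [mem_carrier]
    exact ⟨⟨by linarith, by linarith⟩, by linarith, by linarith⟩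
  · simp [affineEval]

theorem exists_separates_left {R S : AxisRect} (hb : R.bottom ≤ S.bottom) (ht : S.top ≤ R.top)
    (h₁ : S.left ≤ R.left) (h₂ : R.left ≤ S.right) (h₃ : S.right ≤ R.right) :
    ∃ φ, Separates φ R S :=
  exists_separates_of_reflect <| exists_separates_right (R := R.reflect) (S := S.reflect)
    hb ht (neg_le_neg h₃) (neg_le_neg h₂) (neg_le_neg h₁)

theorem exists_separates_top {R S : AxisRect} (hl : R.left ≤ S.left) (hr : S.right ≤ R.right)
    (h₁ : R.bottom ≤ S.bottom) (h₂ : S.bottom ≤ R.top) (h₃ : R.top ≤ S.top) :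
    ∃ φ, Separates φ R S :=
  exists_separates_of_transpose <| exists_separates_right (R := R.transpose) (S := S.transpose)
    hl hr h₁ h₂ h₃

theorem exists_separates_bottom {R S : AxisRect} (hl : R.left ≤ S.left) (hr : S.right ≤ R.right)
    (h₁ : S.bottom ≤ R.bottom) (h₂ : R.bottom ≤ S.top) (h₃ : S.top ≤ R.top) :
    ∃ φ, Separates φ R S :=
  exists_separates_of_transpose <| exists_separates_left (R := R.transpose) (S := S.transpose)
    hl hr h₁ h₂ h₃

/-- If `S` overlaps `R` at the upper right corner of `R`, the falling diagonal of `R ∩ S` separates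
them. When `R ∩ S` is a point, the line of slope `-1` through it is taken. -/
theorem exists_separates_topRight {R S : AxisRect} (h₁ : R.left ≤ S.left) (h₂ : S.left ≤ R.right)
    (h₃ : R.right ≤ S.right) (k₁ : R.bottom ≤ S.bottom) (k₂ : S.bottom ≤ R.top)
    (k₃ : R.top ≤ S.top) : ∃ φ, Separates φ R S := by
  obtain ⟨u, v, hu, hv, huv, hline⟩ : ∃ u v : ℝ, 0 ≤ u ∧ 0 ≤ v ∧ (u ≠ 0 ∨ v ≠ 0) ∧
      u * (R.right - S.left) = v * (R.top - S.bottom) := by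
    by_cases hw : R.right - S.left = 0 ∧ R.top - S.bottom = 0
    · exact ⟨1, 1, by simp, by simp, by simp, by rw [hw.1, hw.2]⟩
    · refine ⟨R.top - S.bottom, R.right - S.left, by linarith, by linarith, ?_, by ring⟩
      tauto
  refine ⟨(u, v, u * S.left + v * R.top), huv, fun x hx hx' => ?_, fun x hx hx' => ?_,
    (S.left, R.top), ?_, ?_, ?_⟩
  · rw [mem_carrier] at hx hx'
    simp only [affineEval]
    by_cases hxl : x.1 < S.left
    · nlinarith [mul_nonneg hu (sub_nonneg.2 hxl.le), mul_nonneg hv (sub_nonneg.2 hx.2.2)]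
    · have hxb : x.2 < S.bottom := by
        by_contra hlt
        exact hx' ⟨⟨by linarith, by linarith⟩, by linarith, by linarith⟩
      nlinarith [mul_nonneg hu (sub_nonneg.2 hx.1.2), mul_nonneg hv (sub_nonneg.2 hxb.le)]
  · rw [mem_carrier] at hx hx'
    simp only [affineEval]
    by_cases hxl : R.right < x.1
    · nlinarith [mul_nonneg hu (sub_nonneg.2 hxl.le), mul_nonneg hv (sub_nonneg.2 hx.2.1)]
    · have hxb : R.top < x.2 := by
        by_contra hlt
        exact hx' ⟨⟨by linarith, by linarith⟩, by linarith, by linarith⟩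
      nlinarith [mul_nonneg hu (sub_nonneg.2 hx.1.1), mul_nonneg hv (sub_nonneg.2 hxb.le)]
  · have := R.bottom_lt_top
    simp only [mem_carrier]
    exact ⟨⟨by linarith, by linarith⟩, by linarith, by linarith⟩
  · have := S.left_lt_right
    simp only [mem_carrier]
    exact ⟨⟨by linarith, by linarith⟩, by linarith, by linarith⟩
  · simp [affineEval]

theorem exists_separates_topLeft {R S : AxisRect} (h₁ : S.left ≤ R.left) (h₂ : R.left ≤ S.right)
    (h₃ : S.right ≤ R.right) (k₁ : R.bottom ≤ S.bottom) (k₂ : S.bottom ≤ R.top)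
    (k₃ : R.top ≤ S.top) : ∃ φ, Separates φ R S :=
  exists_separates_of_reflect <| exists_separates_topRight (R := R.reflect) (S := S.reflect)
    (neg_le_neg h₃) (neg_le_neg h₂) (neg_le_neg h₁) k₁ k₂ k₃

theorem carrier_subset_iff {R S : AxisRect} : R.carrier ⊆ S.carrier ↔
    S.left ≤ R.left ∧ R.right ≤ S.right ∧ S.bottom ≤ R.bottom ∧ R.top ≤ S.top := by
  constructor
  · intro h
    have h₁ := h (a := (R.left, R.bottom))
      ⟨⟨le_rfl, R.left_lt_right.le⟩, ⟨le_rfl, R.bottom_lt_top.le⟩⟩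
    have h₂ := h (a := (R.right, R.top))
      ⟨⟨R.left_lt_right.le, le_rfl⟩, ⟨R.bottom_lt_top.le, le_rfl⟩⟩
    exact ⟨h₁.1.1, h₂.1.2, h₁.2.1, h₂.2.2⟩
  · rintro ⟨h₁, h₂, h₃, h₄⟩ x hx
    exact ⟨⟨h₁.trans hx.1.1, hx.1.2.trans h₂⟩, h₃.trans hx.2.1, hx.2.2.trans h₄⟩

/-- The case in which the horizontal extent of `S` is within that of `R`, and the vertical extent
of `R` within that of `S`: as they do not cross, two of their sides are aligned. -/
theorem exists_separates_of_nested {R S : AxisRect} (hX : R.Intersects S) (hC : ¬ R.Crosses S)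
    (hl : R.left ≤ S.left) (hr : S.right ≤ R.right) (hb : S.bottom ≤ R.bottom)
    (ht : R.top ≤ S.top) : ∃ φ, Separates φ R S := by
  have hR := R.left_lt_right
  have hR' := R.bottom_lt_top
  have hS := S.left_lt_right
  have hS' := S.bottom_lt_top
  by_cases e₁ : S.bottom = R.bottom
  · exact exists_separates_top hl hr e₁.ge (by linarith) ht
  by_cases e₂ : S.top = R.top
  · exact exists_separates_bottom hl hr hb (by linarith) e₂.le
  by_cases e₃ : S.left = R.left
  · exact exists_separates_comm <| exists_separates_right hb ht e₃.le (by linarith) hr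
  by_cases e₄ : S.right = R.right
  · exact exists_separates_comm <| exists_separates_left hb ht hl (by linarith) e₄.ge
  refine absurd ⟨hX, fun p hp hpR => ?_, fun p hp hpS => ?_⟩ hC
  · rw [mem_corners] at hp
    rw [mem_carrier] at hpR
    rcases hp.2 with h | h
    · exact e₁ (le_antisymm hb (by linarith))
    · exact e₂ (le_antisymm (by linarith) ht)
  · rw [mem_corners] at hp
    rw [mem_carrier] at hpS
    rcases hp.1 with h | h
    · exact e₃ (le_antisymm (by linarith) hl)
    · exact e₄ (le_antisymm hr (by linarith))

/-- Intersecting rectangles that do not cross, neither containing the other, are separated. -/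
theorem exists_separates {R S : AxisRect} (hX : R.Intersects S) (hRS : ¬ R.Crosses S)
    (hSR : ¬ S.Crosses R) (h₁ : ¬ R.carrier ⊆ S.carrier) (h₂ : ¬ S.carrier ⊆ R.carrier) :
    ∃ φ, Separates φ R S := by
  rw [carrier_subset_iff] at h₁ h₂
  obtain ⟨p, hpR, hpS⟩ := id hX
  rw [mem_carrier] at hpR hpS
  have a₁ : R.left ≤ S.right := by linarith
  have a₂ : S.left ≤ R.right := by linarith
  have a₃ : R.bottom ≤ S.top := by linarith
  have a₄ : S.bottom ≤ R.top := by linarith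
  rcases le_total R.left S.left with hl | hl <;> rcases le_total R.right S.right with hr | hr <;>
    rcases le_total R.bottom S.bottom with hb | hb <;> rcases le_total R.top S.top with ht | ht
  · exact exists_separates_topRight hl a₂ hr hb a₄ ht
  · exact exists_separates_right hb ht hl a₂ hr
  · exact exists_separates_comm <| exists_separates_left hb ht hl a₂ hr
  · exact exists_separates_comm <| exists_separates_topLeft hl a₂ hr hb a₃ ht
  · exact exists_separates_top hl hr hb a₄ ht
  · exact absurd ⟨hl, hr, hb, ht⟩ h₂
  · exact exists_separates_of_nested hX hRS hl hr hb ht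
  · exact exists_separates_bottom hl hr hb a₃ ht
  · exact exists_separates_comm <| exists_separates_bottom hl hr hb a₄ ht
  · exact exists_separates_comm <| exists_separates_of_nested hX.symm hSR hl hr hb ht
  · exact absurd ⟨hl, hr, hb, ht⟩ h₁
  · exact exists_separates_comm <| exists_separates_top hl hr hb a₃ ht
  · exact exists_separates_topLeft hl a₁ hr hb a₄ ht
  · exact exists_separates_left hb ht hl a₁ hr
  · exact exists_separates_comm <| exists_separates_right hb ht hl a₁ hr
  · exact exists_separates_comm <| exists_separates_topRight hl a₁ hr hb a₃ ht

end AxisRect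

/-! ### Regions of the rectangles that are not contained in others -/

namespace AxisRect

/-- The other rectangles cut out of `R i` finitely many disjoint closed sets, and as `R i` is
connected, they cover it only if one of them does. -/
theorem exists_mem_carrier_forall_notMem {ι : Type*} [Finite ι] {R : ι → AxisRect}
    (hT : TriangleFree R) (C : Set ι) (i : ι)
    (hC : ∀ j ∈ C, j ≠ i → ¬ (R i).carrier ⊆ (R j).carrier) :
    ∃ x ∈ (R i).carrier, ∀ j ∈ C, j ≠ i → x ∉ (R j).carrier := by
  by_contra! hcon
  obtain ⟨z, hz⟩ := (R i).nonempty_carrier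
  obtain ⟨j, hjC, hji, hzj⟩ := hcon z hz
  obtain ⟨y, hyi, hyj⟩ := Set.not_subset.1 (hC j hjC hji)
  let B : Set (ℝ × ℝ) := ⋃ k ∈ {k | k ∈ C ∧ k ≠ i ∧ k ≠ j}, (R k).carrier
  have hB : IsClosed B :=
    (Set.toFinite _).isClosed_biUnion fun k _ => (R k).isClosed_carrier
  have hcov : ∀ x ∈ (R i).carrier, x ∉ (R j).carrier → x ∈ B := by
    intro x hx hxj
    obtain ⟨k, hkC, hki, hxk⟩ := hcon x hx
    exact Set.mem_biUnion (x := k) ⟨hkC, hki, fun h => hxj (h ▸ hxk)⟩ hxk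
  obtain ⟨x, hxi, hxj, hxB⟩ := isPreconnected_closed_iff.1 (R i).convex_carrier.isPreconnected
    (R j).carrier B (R j).isClosed_carrier hB
    (fun x hx => or_iff_not_imp_left.2 (hcov x hx)) ⟨z, hz, hzj⟩ ⟨y, hyi, hcov y hyi hyj⟩
  simp only [B, Set.mem_iUnion] at hxB
  obtain ⟨k, ⟨-, hki, hkj⟩, hxk⟩ := hxB
  exact hT i j k hji.symm hkj.symm hki.symm ⟨⟨x, hxi, hxj⟩, ⟨x, hxj, hxk⟩, ⟨x, hxi, hxk⟩⟩

/-- The points of `R i` on the side of `R i` of its lines `φ i j = 0`, for all `j ∈ C` such that `R j`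
intersects `R i`. -/
def region {ι : Type*} (R : ι → AxisRect) (C : Set ι) (φ : ι → ι → ℝ × ℝ × ℝ) (i : ι) :
    Set (ℝ × ℝ) :=
  {x | x ∈ (R i).carrier ∧ ∀ j ∈ C, j ≠ i → (R i).Intersects (R j) → affineEval (φ i j) x ≤ 0}

theorem convex_region {ι : Type*} (R : ι → AxisRect) (C : Set ι) (φ : ι → ι → ℝ × ℝ × ℝ) (i : ι) :
    Convex ℝ (region R C φ i) := by
  intro x hx y hy a b ha hb hab
  refine ⟨(R i).convex_carrier hx.1 hy.1 ha hb hab, fun j hj hji hX => ?_⟩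
  have h₁ := hx.2 j hj hji hX
  have h₂ := hy.2 j hj hji hX
  have : affineEval (φ i j) (a • x + b • y) =
      a * affineEval (φ i j) x + b * affineEval (φ i j) y := by
    obtain rfl : b = 1 - a := by linarith
    simp only [affineEval, Prod.fst_add, Prod.snd_add, Prod.smul_fst, Prod.smul_snd, smul_eq_mul]
    ring
  rw [this]
  nlinarith

theorem mem_region_of_forall_notMem {ι : Type*} {R : ι → AxisRect} {C : Set ι}
    {φ : ι → ι → ℝ × ℝ × ℝ} {i : ι}
    (hφ : ∀ j ∈ C, j ≠ i → (R i).Intersects (R j) → Separates (φ i j) (R i) (R j)) {x : ℝ × ℝ}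
    (hx : x ∈ (R i).carrier) (hxj : ∀ j ∈ C, j ≠ i → x ∉ (R j).carrier) : x ∈ region R C φ i :=
  ⟨hx, fun j hj hji hX => (hφ j hj hji hX).nonpos x hx (hxj j hj hji)⟩

theorem nonempty_interior_region {ι : Type*} [Finite ι] {R : ι → AxisRect}
    (hT : TriangleFree R) {C : Set ι} {φ : ι → ι → ℝ × ℝ × ℝ} {i : ι}
    (hC : ∀ j ∈ C, j ≠ i → ¬ (R i).carrier ⊆ (R j).carrier)
    (hφ : ∀ j ∈ C, j ≠ i → (R i).Intersects (R j) → Separates (φ i j) (R i) (R j)) :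
    (interior (region R C φ i)).Nonempty := by
  obtain ⟨x, hx, hxj⟩ := exists_mem_carrier_forall_notMem hT C i hC
  let O : Set (ℝ × ℝ) := (⋃ j ∈ {j | j ∈ C ∧ j ≠ i}, (R j).carrier)ᶜ
  have hO : IsOpen O :=
    ((Set.toFinite _).isClosed_biUnion fun k _ => (R k).isClosed_carrier).isOpen_compl
  have hOmem : ∀ y, y ∈ O ↔ ∀ j ∈ C, j ≠ i → y ∉ (R j).carrier := by
    intro y
    simp [O]
  obtain ⟨y, hyO, hyI⟩ := mem_closure_iff.1 ((R i).carrier_subset_closure_interior hx) O hO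
    ((hOmem x).2 hxj)
  refine ⟨y, mem_interior.2 ⟨O ∩ interior (R i).carrier, ?_, hO.inter isOpen_interior, hyO, hyI⟩⟩
  rintro z ⟨hzO, hzI⟩
  exact mem_region_of_forall_notMem hφ (interior_subset hzI) ((hOmem z).1 hzO)

theorem disjoint_interior_region {ι : Type*} {R : ι → AxisRect} {C : Set ι}
    {φ : ι → ι → ℝ × ℝ × ℝ} {i j : ι} (hi : i ∈ C) (hj : j ∈ C) (hij : i ≠ j)
    (hneg : φ j i = -φ i j)
    (hφ : (R i).Intersects (R j) → Separates (φ i j) (R i) (R j)) :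
    Disjoint (interior (region R C φ i)) (region R C φ j) := by
  rw [Set.disjoint_left]
  intro x hxi hxj
  have hX : (R i).Intersects (R j) := ⟨x, (interior_subset hxi).1, hxj.1⟩
  have hx0 : 0 ≤ affineEval (φ i j) x := by
    have := hxj.2 i hi hij hX.symm
    rw [hneg, affineEval_neg] at this
    linarith
  -- Moving from `x` along the gradient of the separating function leaves the side of `R i`.
  let y : ℝ → ℝ × ℝ := fun r => x + r • ((φ i j).1, (φ i j).2.1)
  have hy : Filter.Tendsto y (nhdsWithin 0 (Set.Ioi 0)) (nhds x) := by
    have : Continuous y := by fun_prop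
    have h0 := this.tendsto 0
    simp only [y, zero_smul, add_zero] at h0
    exact h0.mono_left nhdsWithin_le_nhds
  have hyI := hy.eventually (isOpen_interior.mem_nhds hxi)
  obtain ⟨r, hr, hr0⟩ := (hyI.and self_mem_nhdsWithin).exists
  have hle := (interior_subset hr).2 j hj hij.symm hX
  have heq : affineEval (φ i j) (y r) =
      affineEval (φ i j) x + r * ((φ i j).1 ^ 2 + (φ i j).2.1 ^ 2) := by
    simp only [affineEval, y, Prod.fst_add, Prod.snd_add, Prod.smul_mk, smul_eq_mul]
    ring
  have hpos : 0 < (φ i j).1 ^ 2 + (φ i j).2.1 ^ 2 := by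
    rcases (hφ hX).ne_zero with h | h <;> positivity
  have := mul_pos hr0 hpos
  linarith

/-- In a triangle-free family, a common point of two members determines the two members. -/
theorem sym2_eq_of_common_point {ι : Type*} {R : ι → AxisRect} (hT : TriangleFree R) {i j k l : ι}
    (hij : i ≠ j) (hkl : k ≠ l) {x : ℝ × ℝ} (hi : x ∈ (R i).carrier) (hj : x ∈ (R j).carrier)
    (hk : x ∈ (R k).carrier) (hl : x ∈ (R l).carrier) : s(i, j) = s(k, l) := by
  have key : ∀ m, x ∈ (R m).carrier → m = i ∨ m = j := by
    intro m hm
    by_contra! h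
    exact hT i j m hij h.2.symm h.1.symm ⟨⟨x, hi, hj⟩, ⟨x, hj, hm⟩, ⟨x, hi, hm⟩⟩
  rcases key k hk with rfl | rfl <;> rcases key l hl with rfl | rfl
  · exact absurd rfl hkl
  · rfl
  · exact Sym2.eq_swap
  · exact absurd rfl hkl

/-- Separating functions for all pairs can be chosen such that the two half-planes of a pair are
opposite. -/
theorem exists_antisymm_separates {ι : Type*} [LinearOrder ι] {R : ι → AxisRect}
    (hN : NonCrossing R) {C : Set ι}
    (hC : ∀ i ∈ C, ∀ j ∈ C, i ≠ j → ¬ (R i).carrier ⊆ (R j).carrier) :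
    ∃ φ : ι → ι → ℝ × ℝ × ℝ, (∀ i j, i ≠ j → φ j i = -φ i j) ∧
      ∀ i ∈ C, ∀ j ∈ C, i ≠ j → (R i).Intersects (R j) → Separates (φ i j) (R i) (R j) := by
  classical
  have hex : ∀ i j, ∃ ψ, i ∈ C → j ∈ C → i ≠ j → (R i).Intersects (R j) →
      Separates ψ (R i) (R j) := by
    intro i j
    by_cases h : i ∈ C ∧ j ∈ C ∧ i ≠ j ∧ (R i).Intersects (R j)
    · obtain ⟨hi, hj, hij, hX⟩ := h
      obtain ⟨ψ, hψ⟩ := exists_separates hX (hN i j) (hN j i) (hC i hi j hj hij)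
        (hC j hj i hi hij.symm)
      exact ⟨ψ, fun _ _ _ _ => hψ⟩
    · exact ⟨0, fun hi hj hij hX => absurd ⟨hi, hj, hij, hX⟩ h⟩
  choose ψ hψ using hex
  refine ⟨fun i j => if i < j then ψ i j else -ψ j i, fun i j hij => ?_, fun i hi j hj hij hX => ?_⟩
  · rcases lt_or_gt_of_ne hij with h | h
    · simp [h, h.not_gt]
    · simp [h, h.not_gt]
  · rcases lt_or_gt_of_ne hij with h | h
    · simp only [if_pos h]
      exact hψ i j hi hj hij hX
    · simp only [if_neg h.not_gt]
      exact (hψ j i hj hi hij.symm hX.symm).neg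

/-- The common point of two rectangles on their separating line lies in both regions. -/
theorem exists_mem_region_inter_region {ι : Type*} {R : ι → AxisRect} (hT : TriangleFree R)
    {C : Set ι} {φ : ι → ι → ℝ × ℝ × ℝ} (hneg : ∀ i j, i ≠ j → φ j i = -φ i j)
    (hφ : ∀ i ∈ C, ∀ j ∈ C, i ≠ j → (R i).Intersects (R j) → Separates (φ i j) (R i) (R j))
    {i j : ι} (hi : i ∈ C) (hj : j ∈ C) (hij : i ≠ j) (hX : (R i).Intersects (R j)) :
    ∃ x, x ∈ region R C φ i ∧ x ∈ region R C φ j := by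
  obtain ⟨x, hxi, hxj, hx0⟩ := (hφ i hi j hj hij hX).common
  have key : ∀ k, k ≠ i → k ≠ j → x ∉ (R k).carrier := fun k hki hkj hxk =>
    hT i j k hij hkj.symm hki.symm ⟨hX, ⟨x, hxj, hxk⟩, ⟨x, hxi, hxk⟩⟩
  refine ⟨x, ⟨hxi, fun k hk hki hXk => ?_⟩, ⟨hxj, fun k hk hkj hXk => ?_⟩⟩
  · by_cases hkj : k = j
    · rw [hkj, hx0]
    · exact (hφ i hi k hk hki.symm hXk).nonpos x hxi (key k hki hkj)
  · by_cases hki : k = i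
    · rw [hki, hneg i j hij, affineEval_neg, hx0, neg_zero]
    · exact (hφ j hj k hk hkj.symm hXk).nonpos x hxj (key k hki hkj)

/-! ### Leaves: rectangles contained in others -/

/-- `R i` is contained in `R j`; of two equal rectangles, the one with the smaller index counts as
containing the other. -/
def ContainedIn {ι : Type*} [LinearOrder ι] (R : ι → AxisRect) (i j : ι) : Prop :=
  j ≠ i ∧ (R i).carrier ⊆ (R j).carrier ∧ ((R j).carrier ⊆ (R i).carrier → j < i)

/-- Anything that meets the inner rectangle meets the outer one. -/
theorem ContainedIn.eq_of_intersects {ι : Type*} [LinearOrder ι] {R : ι → AxisRect}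
    (hT : TriangleFree R) {i j k : ι} (h : ContainedIn R i j) (hki : k ≠ i)
    (hX : (R i).Intersects (R k)) : k = j := by
  by_contra hkj
  obtain ⟨x, hxi, hxk⟩ := id hX
  exact hT i j k h.1.symm (Ne.symm hkj) hki.symm
    ⟨⟨x, hxi, h.2.1 hxi⟩, ⟨x, h.2.1 hxi, hxk⟩, hX⟩

theorem ContainedIn.not_containedIn {ι : Type*} [LinearOrder ι] {R : ι → AxisRect}
    (hT : TriangleFree R) {i j k : ι} (h : ContainedIn R i j) : ¬ ContainedIn R j k := by
  intro h'
  obtain rfl : i = k := h'.eq_of_intersects hT h.1.symm (intersects_of_subset h.2.1).symm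
  exact lt_asymm (h.2.2 h'.2.1) (h'.2.2 h.2.1)

theorem not_subset_of_forall_not_containedIn {ι : Type*} [LinearOrder ι] {R : ι → AxisRect}
    {i j : ι} (hi : ∀ k, ¬ ContainedIn R i k) (hj : ∀ k, ¬ ContainedIn R j k) (hij : i ≠ j) :
    ¬ (R i).carrier ⊆ (R j).carrier := by
  intro hs
  by_cases hs' : (R j).carrier ⊆ (R i).carrier
  · rcases lt_or_gt_of_ne hij with hlt | hlt
    · exact hj i ⟨hij, hs', fun _ => hlt⟩
    · exact hi j ⟨hij.symm, hs, fun _ => hlt⟩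
  · exact hi j ⟨hij.symm, hs, fun h => absurd h hs'⟩

end AxisRect

theorem mainTheorem4 {ι : Type*} [Finite ι] (R : ι → AxisRect)
    (hT : AxisRect.TriangleFree R) (hN : AxisRect.NonCrossing R) :
    IsPlanarGraph (AxisRect.intersectionGraph R) := by
  classical
  -- The order only orients the separating lines and breaks ties between equal rectangles.
  obtain ⟨n, ⟨num⟩⟩ := Finite.exists_equiv_fin ι
  let : LinearOrder ι := LinearOrder.lift' num num.injective
  let L : Set ι := {i | ∃ j, AxisRect.ContainedIn R i j}
  have hcore : ∀ i ∉ L, ∀ j ∉ L, i ≠ j → ¬ (R i).carrier ⊆ (R j).carrier := fun i hi j hj hij =>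
    AxisRect.not_subset_of_forall_not_containedIn (not_exists.1 hi) (not_exists.1 hj) hij
  obtain ⟨φ, hneg, hφ⟩ := AxisRect.exists_antisymm_separates hN (C := Lᶜ) hcore
  have hhost : ∀ i, ∃ j, i ∈ L → AxisRect.ContainedIn R i j := by
    intro i
    by_cases hi : i ∈ L
    · exact hi.imp fun j hj _ => hj
    · exact ⟨i, fun h => absurd h hi⟩
  choose h hh using hhost
  have hbend : ∀ e : Sym2 ι, ∃ x, e ∈ (AxisRect.intersectionGraph R).edgeSet → (∀ i ∈ e, i ∉ L) →
      ∀ i ∈ e, x ∈ AxisRect.region R Lᶜ φ i := by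
    intro e
    induction e with
    | _ i j =>
    by_cases hij : (AxisRect.intersectionGraph R).Adj i j ∧ i ∉ L ∧ j ∉ L
    · obtain ⟨⟨hne, hX⟩, hi, hj⟩ := hij
      obtain ⟨x, hxi, hxj⟩ := AxisRect.exists_mem_region_inter_region hT hneg hφ hi hj hne hX
      exact ⟨x, fun _ _ k hk => by rcases Sym2.mem_iff.1 hk with rfl | rfl <;> assumption⟩
    · exact ⟨0, fun he hL => absurd ⟨he, hL i (by simp), hL j (by simp)⟩ hij⟩
  choose q hq using hbend
  refine isPlanarGraph_of_convex_regions L h (fun s hs => ?_) (fun s hs v hv => ?_)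
    (AxisRect.region R Lᶜ φ) q (fun v _ => AxisRect.convex_region R Lᶜ φ v) (fun v hv => ?_)
    (fun u hu v hv huv => ?_) (fun u hu v hv huv => ?_) ?_
  · rintro ⟨k, hk⟩
    exact (hh s hs).not_containedIn hT hk
  · exact (hh s hs).eq_of_intersects hT hv.1.symm hv.2
  · exact AxisRect.nonempty_interior_region hT (fun j hj hjv => hcore v hv j hj hjv.symm)
      (fun j hj hjv => hφ v hv j hj hjv.symm)
  · exact AxisRect.disjoint_interior_region hu hv huv (hneg u v huv) (hφ u hu v hv huv)
  · refine hq s(u, v) huv (fun i hi => ?_) u (by simp)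
    rcases Sym2.mem_iff.1 hi with rfl | rfl <;> assumption
  · intro e
    induction e with
    | _ i j =>
    intro he f
    induction f with
    | _ k l =>
    intro hf heL hfL hef
    have hxe := hq s(i, j) he heL
    have hxf := hq s(k, l) hf hfL
    rw [← hef] at hxf
    exact AxisRect.sym2_eq_of_common_point hT he.1 hf.1 (hxe i (by simp)).1 (hxe j (by simp)).1
      (hxf k (by simp)).1 (hxf l (by simp)).1
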